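/- Let $\mathfrak g$ be the compact real Lie algebra of type $\mathrm E_6$, and let $B$ be the negative of its Killing form, which is positive definite. Consider a decomposition of $E_6$-II type $$\mathfrak g=\mathrm T\oplus A_1^1\oplus A_1^2\oplus A_3\oplus\mathfrak p_1\oplus\mathfrak p_2\oplus\mathfrak p_3 ,$$ that is, a $B$-orthogonal direct sum with the following properties. 1. $\mathfrak k=\mathrm T\oplus A_1^1\oplus A_1^2\oplus A_3$ is a subalgebra with one-dimensional center $\mathrm T$, and its simple ideals are $A_1^1\cong A_1^2\cong\mathfrak{su}(2)$ and $A_3\cong\mathfrak{su}(4)$. 2. It is a generalized Wallach decomposition: each $\mathfrak p_i$ is an irreducible $\mathrm{ad}(\mathfrak k)$-module, $[\mathfrak p_i,\mathfrak p_i]\subset\mathfrak k$ for $i\in\{1,2,3\}$, and $[\mathfrak p_i,\mathfrak p_j]\subset\mathfrak p_k$ for $\{i,j,k\}=\{1,2,3\}$. 3. $\mathrm T\oplus A_1^2\oplus A_3\oplus\mathfrak p_1$ and $\mathrm T\oplus A_1^1\oplus A_3\oplus\mathfrak p_2$ are subalgebras isomorphic to $\mathfrak{su}(6)$ (type $A_5$).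 They are the $A_5$-factors of the fixed point algebras $\mathfrak k\oplus\mathfrak p_1$ and $\mathfrak k\oplus\mathfrak p_2$, both of type $A_1\oplus A_5$, of the two commuting involutions of $\mathfrak g$ that define $E_6$-II. Number the summands $0,1,2,3,4,5,6$ in the order written above, and let $\{e^i_\alpha\}_\alpha$ be a $B$-orthonormal basis of the $i$-th summand. Put $$(ijk)=\sum_{\alpha,\beta,\gamma}B([e^i_\alpha,e^j_\beta],e^k_\gamma)^2 .$$ Then, for every choice of these bases, $$\begin{aligned} &(044)=\tfrac12,\quad (055)=\tfrac12,\quad (066)=0,\quad (456)=4,\\ &(111)=\tfrac12,\quad (144)=0,\quad (155)=1,\quad (166)=\tfrac32,\\ &(222)=\tfrac12,\quad (244)=1,\quad (255)=0,\quad (266)=\tfrac32,\\ &(333)=5,\quad (344)=\tfrac52,\quad (355)=\tfrac52,\quad (366)=5, \end{aligned}$$ and $(ijk)=0$ whenever $\{i,j,k\}$, as a multiset, is not one of the sixteen index triples in this list. -/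

import Mathlib

open scoped TensorProduct

/-- `B`, the negative of the Killing form of a real Lie algebra. -/
noncomputable def negKilling (g : Type*) [LieRing g] [LieAlgebra ℝ g] :
    LinearMap.BilinForm ℝ g :=
  -killingForm ℝ g

section

attribute [local instance 100] LieRing.ofAssociativeRing

/-- `su(n)`, the compact real form of type `A_{n-1}`: the real Lie algebra of complex `n × n`
matrices that are skew-Hermitian and of trace zero, with the commutator bracket. -/
noncomputable def suLie (n : ℕ) : LieSubalgebra ℝ (Matrix (Fin n) (Fin n) ℂ) where
  carrier := {A | A.conjTranspose = -A ∧ A.trace = 0}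
  zero_mem' := by simp
  add_mem' := by
    rintro A B ⟨hA, hA'⟩ ⟨hB, hB'⟩
    refine ⟨?_, ?_⟩
    · rw [Matrix.conjTranspose_add, hA, hB]
      abel
    · rw [Matrix.trace_add, hA', hB', add_zero]
  smul_mem' := by
    rintro c A ⟨hA, hA'⟩
    refine ⟨?_, ?_⟩
    · rw [Matrix.conjTranspose_smul, hA, star_trivial, smul_neg]
    · rw [Matrix.trace_smul, hA', smul_zero]
  lie_mem' := by
    rintro A B ⟨hA, -⟩ ⟨hB, -⟩
    refine ⟨?_, ?_⟩
    · rw [Ring.lie_def, Matrix.conjTranspose_sub, Matrix.conjTranspose_mul,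
        Matrix.conjTranspose_mul, hA, hB]
      noncomm_ring
    · rw [Ring.lie_def, Matrix.trace_sub, Matrix.trace_mul_comm, sub_self]

end

/-- A finite-dimensional complex Lie algebra is of type `E₆` if it is semisimple (its Killing form
is nondegenerate) and its root system with respect to a Cartan subalgebra has a base whose Cartan
matrix is, up to a numbering of the simple roots, the Cartan matrix `E₆`. -/
def IsComplexTypeE6 (L : Type*) [LieRing L] [LieAlgebra ℂ L] [FiniteDimensional ℂ L] : Prop :=
  ∃ (_ : LieAlgebra.IsKilling ℂ L) (H : LieSubalgebra ℂ L) (_ : H.IsCartanSubalgebra)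
    (b : (LieAlgebra.IsKilling.rootSystem H).Base) (f : b.support ≃ Fin 6),
    ∀ i j, b.cartanMatrix i j = CartanMatrix.E₆ (f i) (f j)

/-- The compact real Lie algebra of type `E₆`: `B` is positive definite and the complexification
is of type `E₆`. -/
def IsCompactE6 (g : Type*) [LieRing g] [LieAlgebra ℝ g] [FiniteDimensional ℝ g] : Prop :=
  (∀ x : g, x ≠ 0 → 0 < negKilling g x x) ∧ IsComplexTypeE6 (ℂ ⊗[ℝ] g)

section

variable {g : Type*} [LieRing g] [LieAlgebra ℝ g]

/-- The subspace `W` of `g` is a Lie subalgebra of `g` isomorphic to `su(n)`. -/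
def IsSuSubalgebra (W : Submodule ℝ g) (n : ℕ) : Prop :=
  ∃ s : LieSubalgebra ℝ g, s.toSubmodule = W ∧ Nonempty (s ≃ₗ⁅ℝ⁆ suLie n)

/-- The subspace `W` is an irreducible `ad(k)`-module, for a subspace `k` of `g`. -/
def IsIrreducibleUnder (k W : Submodule ℝ g) : Prop :=
  W ≠ ⊥ ∧ (∀ x ∈ k, ∀ w ∈ W, ⁅x, w⁆ ∈ W) ∧
    ∀ U : Submodule ℝ g, U ≤ W → (∀ x ∈ k, ∀ u ∈ U, ⁅x, u⁆ ∈ U) → U = ⊥ ∨ U = W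

/-- The isotropy algebra `k = T ⊕ A₁¹ ⊕ A₁² ⊕ A₃`, spanned by the summands `0, 1, 2, 3`. -/
def isotropyPart (V : Fin 7 → Submodule ℝ g) : Submodule ℝ g :=
  V 0 ⊔ V 1 ⊔ V 2 ⊔ V 3

/-- The generalized Wallach space `E₆`-II, on the level of Lie algebras: the decomposition
`g = T ⊕ A₁¹ ⊕ A₁² ⊕ A₃ ⊕ p₁ ⊕ p₂ ⊕ p₃` of the compact Lie algebra `g` of type `E₆`, with
`V 0 = T`, `V 1 = A₁¹`, `V 2 = A₁²`, `V 3 = A₃`, `V 4 = p₁`, `V 5 = p₂`, `V 6 = p₃`.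

By `lie_self_mem` and `lie_mem`, `k ⊕ p₁` and `k ⊕ p₂` are the fixed point algebras of two
commuting involutive automorphisms of `g`. For the first one this algebra has the shape
`A₁ ⊕ A₅` with `A₁ = A₁¹` and `A₅ = T ⊕ A₁² ⊕ A₃ ⊕ p₁`; for the second one it has the shape
`A₁ ⊕ A₅` with `A₁ = A₁²` and `A₅ = T ⊕ A₁¹ ⊕ A₃ ⊕ p₂`. This fixes which summand is called
`A₁¹`, `A₁²`, `p₁`, `p₂`, `p₃`. -/
structure IsE6II [FiniteDimensional ℝ g] (V : Fin 7 → Submodule ℝ g) : Prop where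
  compactE6 : IsCompactE6 g
  isInternal : DirectSum.IsInternal V
  orthogonal : ∀ i j, i ≠ j → ∀ x ∈ V i, ∀ y ∈ V j, negKilling g x y = 0
  /-- `T` is one-dimensional and central in `k`. -/
  finrank_T : Module.finrank ℝ (V 0) = 1
  T_central : ∀ x ∈ V 0, ∀ y ∈ isotropyPart V, ⁅x, y⁆ = 0
  /-- The simple ideals of `k` have types `A₁`, `A₁`, `A₃`. -/
  typeA1 : IsSuSubalgebra (V 1) 2
  typeA1' : IsSuSubalgebra (V 2) 2
  typeA3 : IsSuSubalgebra (V 3) 4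
  lie_12 : ∀ x ∈ V 1, ∀ y ∈ V 2, ⁅x, y⁆ = 0
  lie_13 : ∀ x ∈ V 1, ∀ y ∈ V 3, ⁅x, y⁆ = 0
  lie_23 : ∀ x ∈ V 2, ∀ y ∈ V 3, ⁅x, y⁆ = 0
  /-- The isotropy summands are irreducible `ad(k)`-modules. -/
  irreducible : ∀ i : Fin 7, 4 ≤ i → IsIrreducibleUnder (isotropyPart V) (V i)
  /-- The bracket relations of a generalized Wallach space. -/
  lie_self_mem : ∀ i : Fin 7, 4 ≤ i → ∀ x ∈ V i, ∀ y ∈ V i, ⁅x, y⁆ ∈ isotropyPart V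
  lie_mem : ∀ i j l : Fin 7, 4 ≤ i → 4 ≤ j → 4 ≤ l → i ≠ j → i ≠ l → j ≠ l →
    ∀ x ∈ V i, ∀ y ∈ V j, ⁅x, y⁆ ∈ V l
  typeA5 : IsSuSubalgebra (V 0 ⊔ V 2 ⊔ V 3 ⊔ V 4) 6
  typeA5' : IsSuSubalgebra (V 0 ⊔ V 1 ⊔ V 3 ⊔ V 5) 6

/-- Bases `e i` of the summands `V i` that are orthonormal with respect to `B`. -/
def IsNegKillingOrthonormal {V : Fin 7 → Submodule ℝ g}
    (e : ∀ i, Module.Basis (Fin (Module.finrank ℝ (V i))) ℝ (V i)) : Prop :=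
  ∀ i a b, negKilling g (e i a : g) (e i b : g) = if a = b then 1 else 0

/-- `(ijk)`, the sum of the squares `B([e^i_α, e^j_β], e^k_γ)²` over all `α, β, γ`. -/
noncomputable def structureCoeff {V : Fin 7 → Submodule ℝ g}
    (e : ∀ i, Module.Basis (Fin (Module.finrank ℝ (V i))) ℝ (V i)) (i j k : Fin 7) : ℝ :=
  ∑ a, ∑ b, ∑ c, (negKilling g ⁅(e i a : g), (e j b : g)⁆ (e k c : g)) ^ 2

end

-- On a subalgebra isomorphic to `su(n)` an invariant inner product is unique up to scale, so minus
-- its own Killing form equals `r·B` for some `r`. Since `ad x` is `B`-skew, minus the Killing form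
-- at `x` is a sum of squares of structure constants. Hence summing `(ijk)` over `j, k` inside the
-- subalgebra gives `r·dim V i` (`exists_ratio_of_isSuSubalgebra`); on `g` itself the ratio is one
-- (`sum_structureCoeff`). Together with the selection rules of the brackets this is a linear
-- system.
--
-- The ratios are tied together by lengths of `su(2)`-triples: minus the Killing form of `su(n)` is
-- at least `4n` on the element `h` of any triple, and the standard triple attains this. So an
-- `su(m)` of ratio `r` inside an `su(n)` of ratio `s` satisfies `n r ≤ m s`, that is, its Dynkin
-- index is at least one. In the first `A₅`, of ratio `γ`, the linear equations give `3r₂ + 15r₃ =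
-- 11γ`, whereas `3r₂ ≤ γ` and `3r₃ ≤ 2γ`; both must be equalities. The second `A₅` contains the
-- same `A₃`, hence has the same ratio, and every coefficient becomes affine in `γ`, with `(066) = 1
-- - 2γ`.
--
-- The center fixes `γ`. For a unit vector `t` of `T`, `(ad t)²` is a scalar on each `pᵢ`, and the
-- derivation property leaves only `(066) = 0` or `18γ² - 17γ + 1 = 0`. The latter has no solution
-- with `72γ = 60 - dim p₃` an integer, so `γ = 1/2`.

attribute [local instance 100] LieRing.ofAssociativeRing

/-! ### Real and complex traces, and the Killing form of `su(n)` -/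

section RealTrace

/-- The real trace of a complex-linear endomorphism is twice the real part of its trace. -/
theorem trace_restrictScalars_real {M : Type*} [AddCommGroup M] [Module ℂ M] [Module ℝ M]
    [IsScalarTower ℝ ℂ M] [FiniteDimensional ℂ M] (f : M →ₗ[ℂ] M) :
    LinearMap.trace ℝ M (f.restrictScalars ℝ) = 2 * (LinearMap.trace ℂ M f).re := by
  classical
  let b := Module.finBasis ℂ M
  rw [LinearMap.trace_eq_matrix_trace ℝ (Complex.basisOneI.smulTower b),
    LinearMap.trace_eq_matrix_trace ℂ b]
  simp only [Matrix.trace, Matrix.diag_apply, LinearMap.toMatrix_apply, Fintype.sum_prod_type,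
    Fin.sum_univ_two, Module.Basis.smulTower_repr_mk, Module.Basis.smulTower_apply,
    Complex.basisOneI, Complex.re_sum, Finset.mul_sum]
  rw [← Finset.sum_add_distrib]
  refine Finset.sum_congr rfl fun i _ => ?_
  simp
  ring

theorem trace_mulLeft_mulRight {n : Type*} [Fintype n] [DecidableEq n] (A B : Matrix n n ℂ) :
    LinearMap.trace ℂ (Matrix n n ℂ) (LinearMap.mulLeft ℂ A ∘ₗ LinearMap.mulRight ℂ B) =
      A.trace * B.trace := by
  rw [LinearMap.trace_eq_matrix_trace ℂ (Matrix.stdBasis ℂ n n)]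
  simp only [Matrix.trace, Matrix.diag_apply, LinearMap.toMatrix_apply, Fintype.sum_prod_type,
    Finset.sum_mul_sum]
  refine Finset.sum_congr rfl fun i _ => Finset.sum_congr rfl fun j _ => ?_
  rw [Matrix.stdBasis_eq_single]
  simp [Matrix.stdBasis, Pi.basis_repr, Matrix.mul_apply, Matrix.single_apply, ite_and]

end RealTrace

section SuLie

variable {n : ℕ}

instance : FiniteDimensional ℝ (suLie n) :=
  inferInstanceAs (FiniteDimensional ℝ (suLie n).toSubmodule)

theorem suLie_conjTranspose (A : suLie n) : (A : Matrix (Fin n) (Fin n) ℂ).conjTranspose = -A :=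
  A.2.1

theorem suLie_trace (A : suLie n) : (A : Matrix (Fin n) (Fin n) ℂ).trace = 0 :=
  A.2.2

/-- `(A, B, c) ↦ A + iB + c`, identifying the complex matrices with two copies of `su(n)` and
the scalars. -/
noncomputable def suLieDecomp (n : ℕ) :
    (suLie n × suLie n) × ℂ →ₗ[ℝ] Matrix (Fin n) (Fin n) ℂ where
  toFun p := p.1.1 + Complex.I • (p.1.2 : Matrix (Fin n) (Fin n) ℂ) + p.2 • 1
  map_add' p q := by
    simp only [Prod.fst_add, Prod.snd_add, AddMemClass.coe_add, smul_add, add_smul]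
    abel
  map_smul' r p := by
    simp only [Prod.smul_fst, Prod.smul_snd, SetLike.val_smul, smul_add, RingHom.id_apply,
      smul_assoc]
    rw [smul_comm Complex.I r]

theorem suLieDecomp_apply (A B : suLie n) (c : ℂ) :
    suLieDecomp n ((A, B), c) = A + Complex.I • (B : Matrix (Fin n) (Fin n) ℂ) + c • 1 := rfl

theorem suLieDecomp_bijective [NeZero n] : Function.Bijective (suLieDecomp n) := by
  have hn : (n : ℂ) ≠ 0 := Nat.cast_ne_zero.2 (NeZero.ne n)
  constructor
  · rw [← LinearMap.ker_eq_bot, LinearMap.ker_eq_bot']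
    rintro ⟨⟨A, B⟩, c⟩ h
    rw [suLieDecomp_apply] at h
    have hc : c = 0 := by
      have := congrArg Matrix.trace h
      simpa [suLie_trace, hn, NeZero.ne n] using this
    subst hc
    rw [zero_smul, add_zero] at h
    have h2 := congrArg Matrix.conjTranspose h
    rw [Matrix.conjTranspose_add, Matrix.conjTranspose_smul, suLie_conjTranspose,
      suLie_conjTranspose, Matrix.conjTranspose_zero] at h2
    have hB : (B : Matrix (Fin n) (Fin n) ℂ) = 0 := by
      have h3 : (2 * Complex.I) • (B : Matrix (Fin n) (Fin n) ℂ) = 0 := by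
        have := congrArg₂ (· + ·) h h2
        simp only [Complex.star_def, Complex.conj_I, smul_neg, neg_smul, neg_neg, add_zero] at this
        rw [← this]
        module
      exact (smul_eq_zero.1 h3).resolve_left (by simp)
    rw [hB, smul_zero, add_zero] at h
    have hA : A = 0 := Subtype.ext h
    have hB' : B = 0 := Subtype.ext hB
    simp [hA, hB']
  · intro M
    set c : ℂ := M.trace / n with hc
    set N : Matrix (Fin n) (Fin n) ℂ := M - c • 1 with hN
    have hNt : N.trace = 0 := by
      simp [hN, hc, Matrix.trace_sub, hn]
    have hNt' : N.conjTranspose.trace = 0 := by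
      rw [Matrix.trace_conjTranspose, hNt, star_zero]
    refine ⟨((⟨(1 / 2 : ℂ) • (N - N.conjTranspose), ?_, ?_⟩,
      ⟨(-(Complex.I / 2)) • (N + N.conjTranspose), ?_, ?_⟩), c), ?_⟩
    · rw [Matrix.conjTranspose_smul, Matrix.conjTranspose_sub, Matrix.conjTranspose_conjTranspose]
      simp only [one_div, star_inv₀, star_ofNat]
      module
    · rw [Matrix.trace_smul, Matrix.trace_sub, hNt, hNt']
      simp
    · rw [Matrix.conjTranspose_smul, Matrix.conjTranspose_add, Matrix.conjTranspose_conjTranspose]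
      simp only [Complex.star_def, map_neg, map_div₀, Complex.conj_I, map_ofNat]
      module
    · rw [Matrix.trace_smul, Matrix.trace_add, hNt, hNt']
      simp
    · rw [suLieDecomp_apply]
      simp only [smul_smul, mul_neg, ← mul_div_assoc, Complex.I_mul_I, hN]
      module

/-- `suLieDecomp` as an equivalence. -/
noncomputable def suLieEquiv (n : ℕ) [NeZero n] :
    ((suLie n × suLie n) × ℂ) ≃ₗ[ℝ] Matrix (Fin n) (Fin n) ℂ :=
  LinearEquiv.ofBijective (suLieDecomp n) suLieDecomp_bijective

theorem suLieEquiv_apply [NeZero n] (A B : suLie n) (c : ℂ) :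
    suLieEquiv n ((A, B), c) = A + Complex.I • (B : Matrix (Fin n) (Fin n) ℂ) + c • 1 := rfl

theorem finrank_suLie (n : ℕ) [NeZero n] : Module.finrank ℝ (suLie n) + 1 = n * n := by
  have h := (suLieEquiv n).finrank_eq
  rw [Module.finrank_prod, Module.finrank_prod, Complex.finrank_real_complex,
    Module.finrank_matrix, Complex.finrank_real_complex, Fintype.card_fin] at h
  lia

theorem killingForm_suLie [NeZero n] (A B : suLie n) :
    killingForm ℝ (suLie n) A B =
      2 * n * ((A : Matrix (Fin n) (Fin n) ℂ) * (B : Matrix (Fin n) (Fin n) ℂ)).trace.re := by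
  set a : Matrix (Fin n) (Fin n) ℂ := A.1 with ha
  set b : Matrix (Fin n) (Fin n) ℂ := B.1 with hb
  set f := LieAlgebra.ad ℝ (suLie n) A ∘ₗ LieAlgebra.ad ℝ (suLie n) B with hf
  set F : Matrix (Fin n) (Fin n) ℂ →ₗ[ℂ] Matrix (Fin n) (Fin n) ℂ :=
    LinearMap.mulLeft ℂ (a * b) ∘ₗ LinearMap.mulRight ℂ 1
      - LinearMap.mulLeft ℂ a ∘ₗ LinearMap.mulRight ℂ b
      - LinearMap.mulLeft ℂ b ∘ₗ LinearMap.mulRight ℂ a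
      + LinearMap.mulLeft ℂ 1 ∘ₗ LinearMap.mulRight ℂ (b * a) with hF
  -- `F` is `ad a ∘ ad b` on all complex matrices. It acts as `f` on each of the two copies of
  -- `su(n)` and kills the scalars, so the doubled trace of `f` cancels the factor 2 of
  -- `trace_restrictScalars_real`.
  have hconj : (suLieEquiv n).conj ((f.prodMap f).prodMap 0) = F.restrictScalars ℝ := by
    ext1 X
    obtain ⟨⟨⟨P, Q⟩, c⟩, rfl⟩ := (suLieEquiv n).surjective X
    rw [LinearEquiv.conj_apply_apply, LinearEquiv.symm_apply_apply, LinearMap.prodMap_apply,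
      LinearMap.prodMap_apply, suLieEquiv_apply, suLieEquiv_apply]
    simp only [hf, hF, LinearMap.comp_apply, LieAlgebra.ad_apply, LieSubalgebra.coe_bracket,
      LinearMap.zero_apply, LinearMap.restrictScalars_apply, LinearMap.add_apply,
      LinearMap.sub_apply, LinearMap.mulLeft_apply, LinearMap.mulRight_apply, Ring.lie_def,
      mul_one, one_mul, zero_smul, add_zero, mul_add, add_mul, mul_sub, sub_mul, smul_sub,
      mul_smul_comm, smul_mul_assoc, mul_assoc, a, b]
    abel
  have h1 := trace_restrictScalars_real F
  rw [← hconj, LinearMap.trace_conj', LinearMap.trace_prodMap', LinearMap.trace_prodMap',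
    map_zero, add_zero] at h1
  simp only [hF, map_add, map_sub, trace_mulLeft_mulRight, a, b, suLie_trace] at h1
  rw [killingForm_apply_apply, ← hf]
  rw [Matrix.trace_mul_comm (B : Matrix (Fin n) (Fin n) ℂ)] at h1
  simp [Matrix.trace_one] at h1
  linarith

end SuLie

/-! ### Lengths of `sl₂`- and `su(2)`-triples -/

section SlTwo

variable {n : Type*} [Fintype n] [DecidableEq n]

theorem trace_mul_self_eq_sum_sq_eigenvalues {H : Matrix n n ℂ} (hH : H.IsHermitian) :
    (H * H).trace = ((∑ i, hH.eigenvalues i ^ 2 : ℝ) : ℂ) := by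
  have h := hH.spectral_theorem
  have h2 : H * H = Unitary.conjStarAlgAut ℂ _ hH.eigenvectorUnitary
      (Matrix.diagonal (RCLike.ofReal ∘ hH.eigenvalues) *
        Matrix.diagonal (RCLike.ofReal ∘ hH.eigenvalues)) := by
    rw [map_mul, ← h]
  rw [h2, Unitary.conjStarAlgAut_apply, Matrix.trace_mul_comm, ← mul_assoc]
  simp [Matrix.trace_diagonal, pow_two]

/-- The semisimple element of a nonzero `sl₂`-triple, if Hermitian and traceless, has an
eigenvalue which is at least one. -/
theorem exists_one_le_mem_spectrum {H E F : Matrix n n ℂ} (t : IsSl2Triple H E F)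
    (hH : H.IsHermitian) (htr : H.trace = 0) : ∃ μ ∈ spectrum ℝ H, 1 ≤ μ := by
  have hne : Nonempty n := by
    by_contra hcon
    rw [not_nonempty_iff] at hcon
    exact t.h_ne_zero (Subsingleton.elim _ _)
  obtain ⟨i, hi⟩ := Finite.exists_max hH.eigenvalues
  refine ⟨hH.eigenvalues i, hH.eigenvalues_mem_spectrum_real i, ?_⟩
  have hpos : 0 < hH.eigenvalues i := by
    by_contra hcon
    push Not at hcon
    apply t.h_ne_zero
    rw [← hH.eigenvalues_eq_zero_iff]
    have hs : ∑ j, hH.eigenvalues j = 0 := by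
      have h := hH.trace_eq_sum_eigenvalues
      rw [htr] at h
      apply Complex.ofReal_injective
      rw [Complex.ofReal_sum]
      exact h.symm
    rw [Finset.sum_eq_zero_iff_of_nonpos fun j _ => (hi j).trans hcon] at hs
    funext j
    exact hs j (Finset.mem_univ j)
  set v : n → ℂ := (hH.eigenvectorBasis i).ofLp with hv
  have hHv : H.mulVec v = (hH.eigenvalues i : ℂ) • v := hH.mulVec_eigenvectorBasis i
  have hv0 : v ≠ 0 := by
    intro h
    apply hH.eigenvectorBasis.orthonormal.ne_zero i
    ext k
    exact congrFun h k
  -- `E` raises eigenvalues by 2 and the eigenvalue of `v` is maximal, so `v` is a highest weight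
  -- vector. Its weight is then a natural number, and it is positive.
  have hEv : E.mulVec v = 0 := by
    by_contra hcon
    have h1 : H.mulVec (E.mulVec v) = ((hH.eigenvalues i + 2 : ℝ) : ℂ) • E.mulVec v := by
      have h2 := t.lie_h_e_nsmul
      rw [Ring.lie_def, sub_eq_iff_eq_add] at h2
      rw [Matrix.mulVec_mulVec, h2, Matrix.add_mulVec, ← Matrix.mulVec_mulVec, hHv,
        Matrix.mulVec_smul, two_nsmul, Matrix.add_mulVec]
      push_cast
      module
    have h2 : Module.End.HasEigenvalue (Matrix.toLin' H) ((hH.eigenvalues i + 2 : ℝ) : ℂ) :=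
      Module.End.hasEigenvalue_of_hasEigenvector
        (x := E.mulVec v) ⟨Module.End.mem_eigenspace_iff.2 h1, hcon⟩
    have h3 := h2.mem_spectrum
    rw [Matrix.spectrum_toLin'] at h3
    have h4 : hH.eigenvalues i + 2 ∈ spectrum ℝ H :=
      (spectrum.algebraMap_mem_iff ℂ).1 h3
    rw [hH.spectrum_real_eq_range_eigenvalues] at h4
    obtain ⟨j, hj⟩ := h4
    linarith [hi j]
  have t' : IsSl2Triple (Matrix.toLin' H) (Matrix.toLin' E) (Matrix.toLin' F) := by
    have hl : ∀ A B : Matrix n n ℂ, ⁅Matrix.toLin' A, Matrix.toLin' B⁆ = Matrix.toLin' ⁅A, B⁆ := by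
      intro A B
      simp only [Ring.lie_def, map_sub, Matrix.toLin'_mul, Module.End.mul_eq_comp]
    refine ⟨?_, ?_, ?_, ?_⟩
    · simpa using t.h_ne_zero
    · rw [hl, t.lie_e_f]
    · rw [hl, t.lie_h_e_nsmul, map_nsmul]
    · rw [hl, t.lie_h_f_nsmul, map_neg, map_nsmul]
  have P : t'.HasPrimitiveVectorWith v ((hH.eigenvalues i : ℝ) : ℂ) :=
    ⟨hv0, hHv, hEv⟩
  obtain ⟨k, hk⟩ := P.exists_nat
  have hk' : hH.eigenvalues i = k := by exact_mod_cast hk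
  rw [hk'] at hpos ⊢
  exact_mod_cast hpos

/-- The triple yields an eigenvalue at least `1`, and the opposite triple, with `-H`, one at most
`-1`; each contributes at least `1` to the sum of squares. -/
theorem two_le_trace_mul_self {H E F : Matrix n n ℂ} (t : IsSl2Triple H E F)
    (hH : H.IsHermitian) (htr : H.trace = 0) : 2 ≤ (H * H).trace.re := by
  obtain ⟨μ, hμ, hμ1⟩ := exists_one_le_mem_spectrum t hH htr
  obtain ⟨ν, hν, hν1⟩ := exists_one_le_mem_spectrum t.symm hH.neg (by simp [htr])
  rw [← spectrum.neg_eq, Set.mem_neg] at hν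
  rw [hH.spectrum_real_eq_range_eigenvalues] at hμ hν
  obtain ⟨i, hi⟩ := hμ
  obtain ⟨j, hj⟩ := hν
  have hij : i ≠ j := by
    rintro rfl
    linarith
  rw [trace_mul_self_eq_sum_sq_eigenvalues hH, Complex.ofReal_re]
  have h := Finset.add_le_sum (s := Finset.univ) (f := fun k => hH.eigenvalues k ^ 2)
    (fun k _ => sq_nonneg _) (Finset.mem_univ i) (Finset.mem_univ j) hij
  simp only [hi, hj] at h
  nlinarith

end SlTwo

/-- Elements `h, x, y` of a real Lie algebra satisfying the relations of the standard generators
of `su(2)`, with `h ≠ 0`. -/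
structure IsSuTwoTriple {L : Type*} [LieRing L] (h x y : L) : Prop where
  h_ne_zero : h ≠ 0
  lie_h_x : ⁅h, x⁆ = 2 • y
  lie_h_y : ⁅h, y⁆ = -(2 • x)
  lie_x_y : ⁅x, y⁆ = 2 • h

theorem IsSuTwoTriple.map {R L L' : Type*} [CommRing R] [LieRing L] [LieAlgebra R L] [LieRing L']
    [LieAlgebra R L'] {h x y : L} (t : IsSuTwoTriple h x y) (f : L →ₗ⁅R⁆ L')
    (hf : Function.Injective f) : IsSuTwoTriple (f h) (f x) (f y) where
  h_ne_zero := (map_ne_zero_iff f hf).2 t.h_ne_zero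
  lie_h_x := by rw [← LieHom.map_lie, t.lie_h_x, map_nsmul]
  lie_h_y := by rw [← LieHom.map_lie, t.lie_h_y, map_neg, map_nsmul]
  lie_x_y := by rw [← LieHom.map_lie, t.lie_x_y, map_nsmul]

section SuLie

variable {n : ℕ}

theorem IsSuTwoTriple.trace_mul_self_le {h x y : suLie n} (t : IsSuTwoTriple h x y) :
    ((h : Matrix (Fin n) (Fin n) ℂ) * (h : Matrix (Fin n) (Fin n) ℂ)).trace.re ≤ -2 := by
  have hne : (h : Matrix (Fin n) (Fin n) ℂ) ≠ 0 := fun h0 => t.h_ne_zero (Subtype.ext h0)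
  have e1 : ⁅h.1, x.1⁆ = 2 • y.1 := congrArg Subtype.val t.lie_h_x
  have e2 : ⁅h.1, y.1⁆ = -(2 • x.1) := congrArg Subtype.val t.lie_h_y
  have e3 : ⁅x.1, y.1⁆ = 2 • h.1 := congrArg Subtype.val t.lie_x_y
  have e4 : ⁅y.1, x.1⁆ = -(2 • h.1) := by rw [← lie_skew, e3]
  have c1 := suLie_conjTranspose h
  have c2 := suLie_trace h
  -- The factor `-i` makes the skew-Hermitian `h` Hermitian; the third entry is the adjoint of the
  -- second.
  have T : IsSl2Triple ((-Complex.I) • h.1) ((1 / 2 : ℂ) • (x.1 - Complex.I • y.1))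
      ((1 / 2 : ℂ) • (-x.1 - Complex.I • y.1)) := by
    have hI : Complex.I * Complex.I = -1 := Complex.I_mul_I
    refine ⟨smul_ne_zero (by simp) hne, ?_, ?_, ?_⟩
    · simp only [lie_sub, sub_lie, lie_smul, smul_lie, lie_neg, lie_self, e3, e4]
      module
    · simp only [lie_sub, lie_smul, smul_lie, e1, e2]
      match_scalars <;> first | linear_combination (-1) * hI | linear_combination hI | ring
    · simp only [lie_sub, lie_smul, smul_lie, lie_neg, e1, e2]
      match_scalars <;> first | linear_combination (-1) * hI | linear_combination hI | ring
  have hH : ((-Complex.I) • h.1).IsHermitian := by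
    rw [Matrix.IsHermitian, Matrix.conjTranspose_smul, c1]
    simp
  have h2 := two_le_trace_mul_self T hH (by rw [Matrix.trace_smul, c2, smul_zero])
  rw [smul_mul_smul_comm, Matrix.trace_smul, neg_mul_neg, Complex.I_mul_I] at h2
  simp only [smul_eq_mul, neg_mul, one_mul, Complex.neg_re] at h2
  linarith

/-- The `su(2)` on two coordinates shows that the bound of `IsSuTwoTriple.trace_mul_self_le` is
sharp. -/
theorem exists_isSuTwoTriple_suLie (hn : 2 ≤ n) : ∃ h x y : suLie n, IsSuTwoTriple h x y ∧
    ((h : Matrix (Fin n) (Fin n) ℂ) * (h : Matrix (Fin n) (Fin n) ℂ)).trace.re = -2 := by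
  obtain ⟨i, j, hij⟩ : ∃ i j : Fin n, i ≠ j := ⟨⟨0, by lia⟩, ⟨1, by lia⟩, by simp⟩
  have hI : Complex.I * Complex.I = -1 := Complex.I_mul_I
  have hji := hij.symm
  refine ⟨⟨Complex.I • (Matrix.single i i 1 - Matrix.single j j 1), ?_, ?_⟩,
    ⟨Matrix.single i j 1 - Matrix.single j i 1, ?_, ?_⟩,
    ⟨Complex.I • (Matrix.single i j 1 + Matrix.single j i 1), ?_, ?_⟩,
    ⟨fun h0 => ?_, Subtype.ext ?_, Subtype.ext ?_, Subtype.ext ?_⟩, ?_⟩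
  · simp [Matrix.conjTranspose_smul]
  · simp [Matrix.trace_smul]
  · simp
  · simp [Matrix.trace_sub, Matrix.trace_single_eq_of_ne, hij, hji]
  · simp [Matrix.conjTranspose_smul, add_comm, -Matrix.smul_single]
  · simp [Matrix.trace_add, Matrix.trace_single_eq_of_ne, hij, hji]
  · have := congrFun (congrFun (congrArg Subtype.val h0) i) i
    simp [hji] at this
  · change ⁅_, _⁆ = _
    simp [Ring.lie_def, mul_sub, sub_mul, hij, hji, two_mul, -Matrix.smul_single]
    module
  · change ⁅_, _⁆ = _
    simp [Ring.lie_def, mul_sub, sub_mul, mul_add, add_mul, hij, hji, two_mul, smul_smul, smul_sub,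
      -Matrix.smul_single]
    module
  · change ⁅_, _⁆ = _
    simp [Ring.lie_def, mul_sub, sub_mul, mul_add, add_mul, hij, hji, two_mul, -Matrix.smul_single]
    module
  · simp [mul_sub, sub_mul, hij, hji]
    norm_num

end SuLie

/-! ### The centroid of `su(n)` -/

section Centroid

variable {n : ℕ}

/-- A real-linear endomorphism of the complex matrices which commutes with the adjoint action is
multiplication by a single complex number on all the off-diagonal matrix units. -/
theorem exists_smul_single_of_map_lie
    (S : Matrix (Fin n) (Fin n) ℂ →ₗ[ℝ] Matrix (Fin n) (Fin n) ℂ)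
    (hS : ∀ x y : Matrix (Fin n) (Fin n) ℂ, S ⁅x, y⁆ = ⁅x, S y⁆) :
    ∃ c : ℂ, ∀ i j, i ≠ j → S (Matrix.single i j 1) = c • Matrix.single i j 1 := by
  -- The image of the matrix unit is still an eigenvector of `ad` of the `i`-th and `j`-th diagonal
  -- units, with eigenvalues `1` and `-1`. Comparing entries leaves only position `(i, j)`.
  have key : ∀ i j : Fin n, i ≠ j →
      S (Matrix.single i j 1) = S (Matrix.single i j 1) i j • Matrix.single i j 1 := by
    intro i j hij
    have e1 : ⁅(Matrix.single i i 1 : Matrix (Fin n) (Fin n) ℂ),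
        (Matrix.single i j 1 : Matrix (Fin n) (Fin n) ℂ)⁆ =
        Matrix.single i j 1 := by
      simp [Ring.lie_def, hij.symm]
    have e2 : ⁅(Matrix.single j j 1 : Matrix (Fin n) (Fin n) ℂ),
        (Matrix.single i j 1 : Matrix (Fin n) (Fin n) ℂ)⁆ =
        -Matrix.single i j 1 := by
      simp [Ring.lie_def, hij.symm]
    have h1 := hS (Matrix.single i i 1) (Matrix.single i j 1)
    have h2 := hS (Matrix.single j j 1) (Matrix.single i j 1)
    rw [e1] at h1
    rw [e2, map_neg] at h2
    generalize S (Matrix.single i j 1) = M at *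
    ext p q
    have h1' := congrFun (congrFun h1 p) q
    have h2' := congrFun (congrFun h2 p) q
    simp only [Ring.lie_def, Matrix.sub_apply, Matrix.neg_apply, Matrix.mul_apply,
      Matrix.single_apply, ite_and, ite_mul, mul_ite, one_mul, mul_one, zero_mul, mul_zero,
      Finset.sum_ite_eq, Finset.mem_univ, if_true, Finset.sum_ite_irrel,
      Finset.sum_const_zero] at h1' h2'
    simp only [Matrix.smul_apply, Matrix.single_apply, smul_eq_mul]
    by_cases hp : i = p
    · subst hp
      by_cases hq : j = q
      · subst hq
        simp
      · simpa [hq, hij.symm] using h2'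
    · by_cases hq : i = q
      · subst hq
        simpa [hp, self_eq_neg] using h1'
      · simpa [hp, hq] using h1'
  have mulsame : ∀ i j k : Fin n, i ≠ k →
      ⁅(Matrix.single i j 1 : Matrix (Fin n) (Fin n) ℂ),
          (Matrix.single j k 1 : Matrix (Fin n) (Fin n) ℂ)⁆ =
        Matrix.single i k 1 := by
    intro i j k hik
    simp [Ring.lie_def, hik.symm]
  have hcol : ∀ i j k : Fin n, i ≠ k → j ≠ k →
      S (Matrix.single i k 1) i k = S (Matrix.single j k 1) j k := by
    intro i j k hik hjk
    have h1 := hS (Matrix.single i j 1) (Matrix.single j k 1)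
    rw [mulsame i j k hik, key j k hjk, lie_smul, mulsame i j k hik] at h1
    have h2 := congrFun (congrFun h1 i) k
    simpa using h2
  have hsym : ∀ i j : Fin n, i ≠ j →
      S (Matrix.single i j 1) i j = S (Matrix.single j i 1) j i := by
    intro i j hij
    have h1 := hS (Matrix.single i j 1) (Matrix.single j i 1)
    have h2 := hS (Matrix.single j i 1) (Matrix.single i j 1)
    rw [← lie_skew, map_neg, h2, key j i hij.symm, key i j hij, lie_smul, lie_smul,
      ← lie_skew, smul_neg, neg_neg] at h1
    have h3 := congrFun (congrFun h1 i) i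
    simpa [Ring.lie_def, hij, hij.symm] using h3
  by_cases hn : ∃ i j : Fin n, i ≠ j
  · obtain ⟨i, j, hij⟩ := hn
    refine ⟨S (Matrix.single i j 1) i j, fun k l hkl => ?_⟩
    rw [key k l hkl]
    congr 1
    by_cases hkj : k = j
    · subst hkj
      rw [hsym k l hkl]
      exact hcol l i k hkl.symm hij
    · rw [hcol i k j hij hkj, hsym k j hkj, hsym k l hkl]
      exact hcol l j k hkl.symm (Ne.symm hkj)
  · push Not at hn
    exact ⟨0, fun i j hij => absurd (hn i j) hij⟩

/-- The centroid of `su(n)` consists of the real scalars. -/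
theorem suLie_centroid (hn : 2 ≤ n) (S : suLie n →ₗ[ℝ] suLie n)
    (hS : ∀ x y : suLie n, S ⁅x, y⁆ = ⁅x, S y⁆) : ∃ c : ℝ, ∀ x, S x = c • x := by
  have : NeZero n := ⟨by lia⟩
  -- Extend `S` to all complex matrices, by zero on the scalars, so that matrix units become
  -- available.
  set T := (suLieEquiv n).conj ((S.prodMap S).prodMap (0 : ℂ →ₗ[ℝ] ℂ)) with hT
  have hTapp : ∀ P Q c, T (suLieEquiv n ((P, Q), c)) = suLieEquiv n ((S P, S Q), 0) := by
    intro P Q c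
    rw [hT, LinearEquiv.conj_apply_apply, LinearEquiv.symm_apply_apply]
    rfl
  have hlie : ∀ A B P Q c d, ⁅suLieEquiv n ((A, B), c), suLieEquiv n ((P, Q), d)⁆ =
      suLieEquiv n ((⁅A, P⁆ - ⁅B, Q⁆, ⁅A, Q⁆ + ⁅B, P⁆), 0) := by
    intro A B P Q c d
    simp only [suLieEquiv_apply, AddSubgroupClass.coe_sub, AddMemClass.coe_add,
      LieSubalgebra.coe_bracket, Ring.lie_def, add_mul, mul_add, smul_mul_assoc, mul_smul_comm,
      mul_one, one_mul, smul_add, smul_sub, smul_smul, Complex.I_mul_I]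
    module
  have hTlie : ∀ X Y : Matrix (Fin n) (Fin n) ℂ, T ⁅X, Y⁆ = ⁅X, T Y⁆ := by
    intro X Y
    obtain ⟨⟨⟨A, B⟩, c⟩, rfl⟩ := (suLieEquiv n).surjective X
    obtain ⟨⟨⟨P, Q⟩, d⟩, rfl⟩ := (suLieEquiv n).surjective Y
    rw [hlie, hTapp, hTapp, hlie]
    simp only [map_sub, map_add, hS]
  obtain ⟨c, hc⟩ := exists_smul_single_of_map_lie T hTlie
  have hTS : ∀ x : suLie n, T (x : Matrix (Fin n) (Fin n) ℂ) = S x := by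
    intro x
    have := hTapp x 0 0
    simpa [suLieEquiv_apply] using this
  have hSc : ∀ x : suLie n, (S x : Matrix (Fin n) (Fin n) ℂ) = c • x.1 := by
    intro x
    -- Evaluating `T` on the bracket of `x` with a matrix unit through either argument shows that `S
    -- x - c x` commutes with off-diagonal units. It is thus a scalar matrix, and zero because it is
    -- traceless.
    have hcomm : Pairwise fun i j : Fin n =>
        Commute (Matrix.single i j (1 : ℂ)) ((S x : Matrix (Fin n) (Fin n) ℂ) - c • x.1) := by
      intro i j hij
      have h1 := hTlie x.1 (Matrix.single i j 1)
      have h2 := hTlie (Matrix.single i j 1) x.1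
      rw [← lie_skew, map_neg, h1, hc i j hij, lie_smul, hTS, ← lie_skew, smul_neg, neg_neg] at h2
      rw [commute_iff_lie_eq, lie_sub, lie_smul, ← h2, sub_self]
    obtain ⟨z, hz⟩ := Matrix.mem_range_scalar_of_commute_single hcomm
    have htr := congrArg Matrix.trace hz
    rw [Matrix.trace_sub, Matrix.trace_smul, suLie_trace, suLie_trace, smul_zero, sub_zero] at htr
    have hz0 : z = 0 := by
      simpa [Matrix.scalar_apply, Matrix.trace_diagonal, NeZero.ne n] using htr
    rw [hz0, map_zero] at hz
    exact sub_eq_zero.1 hz.symm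
  obtain ⟨h, x, y, t, ht⟩ := exists_isSuTwoTriple_suLie hn
  have hreal : (c.re : ℂ) = c := by
    have h1 := suLie_conjTranspose (S h)
    rw [hSc, Matrix.conjTranspose_smul, suLie_conjTranspose, smul_neg, neg_inj] at h1
    have h2 := smul_left_injective ℂ (fun h0 => t.h_ne_zero (Subtype.ext h0)) h1
    exact Complex.conj_eq_iff_re.1 h2
  refine ⟨c.re, fun x => Subtype.ext ?_⟩
  rw [hSc, ← hreal]
  rfl

end Centroid

/-! ### Invariant inner products and orthonormal bases -/

section OrthonormalBasis

variable {L : Type*} [AddCommGroup L] [Module ℝ L] {β : LinearMap.BilinForm ℝ L}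
  {ι : Type*} [Fintype ι] [DecidableEq ι] {b : Module.Basis ι ℝ L}

theorem repr_eq_of_orthonormal (hb : ∀ i j, β (b i) (b j) = if i = j then 1 else 0) (x : L)
    (j : ι) : b.repr x j = β x (b j) := by
  conv_rhs => rw [← b.sum_repr x]
  simp [hb, LinearMap.sum_apply, -Module.Basis.sum_repr]

theorem eq_of_forall_apply_basis (hb : ∀ i j, β (b i) (b j) = if i = j then 1 else 0) {x y : L}
    (h : ∀ z, β x z = β y z) : x = y := by
  apply b.repr.injective
  ext j
  rw [repr_eq_of_orthonormal hb, repr_eq_of_orthonormal hb, h]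

theorem apply_self_eq_sum_sq (hb : ∀ i j, β (b i) (b j) = if i = j then 1 else 0) (x : L) :
    β x x = ∑ j, β x (b j) ^ 2 := by
  conv_lhs => enter [2]; rw [← b.sum_repr x]
  simp [repr_eq_of_orthonormal hb, pow_two, -Module.Basis.sum_repr]

end OrthonormalBasis

section InvariantForm

variable {L : Type*} [LieRing L] [LieAlgebra ℝ L] {β : LinearMap.BilinForm ℝ L}
  {ι : Type*} [Fintype ι] [DecidableEq ι] {b : Module.Basis ι ℝ L}

/-- Invariance makes `ad x` skew, so minus the trace of its square is its Hilbert–Schmidt norm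
squared. -/
theorem neg_killingForm_apply_self (hinv : ∀ x y z : L, β ⁅x, y⁆ z = -β y ⁅x, z⁆)
    (hb : ∀ i j, β (b i) (b j) = if i = j then 1 else 0) (x : L) :
    -killingForm ℝ L x x = ∑ i, ∑ j, β ⁅x, b i⁆ (b j) ^ 2 := by
  rw [killingForm_apply_apply, LinearMap.trace_eq_matrix_trace ℝ b, Matrix.trace,
    ← Finset.sum_neg_distrib]
  refine Finset.sum_congr rfl fun i _ => ?_
  rw [Matrix.diag_apply, LinearMap.toMatrix_apply, repr_eq_of_orthonormal hb,
    LinearMap.comp_apply, LieAlgebra.ad_apply, LieAlgebra.ad_apply, hinv, neg_neg,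
    apply_self_eq_sum_sq hb]

/-- On a Lie algebra isomorphic to `su(n)` every invariant inner product is proportional to the
Killing form, and the factor is bounded by the length of any `su(2)`-triple. -/
theorem exists_killingForm_ratio {n : ℕ} (hn : 2 ≤ n) (e : L ≃ₗ⁅ℝ⁆ suLie n)
    (hinv : ∀ x y z : L, β ⁅x, y⁆ z = -β y ⁅x, z⁆)
    (hb : ∀ i j, β (b i) (b j) = if i = j then 1 else 0) :
    ∃ r : ℝ, (∀ x, ∑ i, ∑ j, β ⁅x, b i⁆ (b j) ^ 2 = r * β x x) ∧
      (∃ h x y, IsSuTwoTriple h x y ∧ r * β h h = 4 * n) ∧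
      ∀ h x y, IsSuTwoTriple h x y → 4 * n ≤ r * β h h := by
  have : NeZero n := ⟨by lia⟩
  set κ := killingForm ℝ L with hκ
  have hκinv : ∀ x y z : L, κ ⁅x, y⁆ z = -κ y ⁅x, z⁆ := by
    intro x y z
    rw [← lie_skew, map_neg, LinearMap.neg_apply, LieModule.traceForm_apply_lie_apply]
  -- `S` represents minus the Killing form relative to `β`. Invariance of both forms puts it in the
  -- centroid, hence it is a scalar `r`.
  let S : L →ₗ[ℝ] L := ∑ i, (-κ.flip (b i)).smulRight (b i)
  have hSβ : ∀ x z, β (S x) z = -κ x z := by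
    intro x z
    have h1 : ∀ j, β (S x) (b j) = -κ x (b j) := by
      intro j
      simp [S, hb, LinearMap.sum_apply]
    conv_lhs => rw [← b.sum_repr z]
    conv_rhs => rw [← b.sum_repr z]
    simp only [map_sum, map_smul, h1, smul_neg, Finset.sum_neg_distrib]
  have hS : ∀ x y : L, S ⁅x, y⁆ = ⁅x, S y⁆ := by
    intro x y
    apply eq_of_forall_apply_basis hb
    intro z
    rw [hSβ, hκinv, hinv, hSβ]
  obtain ⟨r, hr⟩ := suLie_centroid hn ((e : L →ₗ[ℝ] suLie n) ∘ₗ S ∘ₗ (e.symm : suLie n →ₗ[ℝ] L))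
    (by
      intro x y
      change e (S (e.symm ⁅x, y⁆)) = ⁅x, e (S (e.symm y))⁆
      rw [LieEquiv.map_lie, hS, LieEquiv.map_lie, LieEquiv.apply_symm_apply])
  have hSr : ∀ x, S x = r • x := by
    intro x
    have h1 : e (S (e.symm (e x))) = r • e x := hr (e x)
    rw [LieEquiv.symm_apply_apply, ← map_smul] at h1
    exact e.injective h1
  have hrκ : ∀ x, -κ x x = r * β x x := by
    intro x
    rw [← hSβ, hSr, map_smul, LinearMap.smul_apply, smul_eq_mul]
  refine ⟨r, fun x => ?_, ?_, fun h x y t => ?_⟩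
  · rw [← neg_killingForm_apply_self hinv hb, ← hrκ]
  · obtain ⟨h, x, y, t, ht⟩ := exists_isSuTwoTriple_suLie hn
    refine ⟨e.symm h, e.symm x, e.symm y, t.map (e.symm : suLie n →ₗ⁅ℝ⁆ L) e.symm.injective, ?_⟩
    rw [← hrκ, hκ, LieAlgebra.killingForm_of_equiv_apply, killingForm_suLie, ht]
    ring
  · have h1 := (t.map (e : L →ₗ⁅ℝ⁆ suLie n) e.injective).trace_mul_self_le
    have h2 := killingForm_suLie (e h) (e h)
    rw [LieAlgebra.killingForm_of_equiv_apply] at h2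
    rw [← hrκ, hκ, h2]
    have hn0 : (0 : ℝ) < n := by exact_mod_cast NeZero.pos n
    have h3 := mul_le_mul_of_nonneg_left h1 hn0.le
    change (n : ℝ) * ((e h : Matrix (Fin n) (Fin n) ℂ) * (e h : Matrix (Fin n) (Fin n) ℂ)).trace.re
      ≤ n * -2 at h3
    linarith

end InvariantForm

/-! ### Symmetry and sum rules of the structure coefficients -/

section NegKilling

variable {g : Type*} [LieRing g] [LieAlgebra ℝ g]

theorem negKilling_lie (x y z : g) : negKilling g ⁅x, y⁆ z = -negKilling g y ⁅x, z⁆ := by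
  simp only [negKilling, LinearMap.neg_apply]
  rw [← lie_skew, map_neg, LinearMap.neg_apply, LieModule.traceForm_apply_lie_apply]

theorem negKilling_comm (x y : g) : negKilling g x y = negKilling g y x := by
  simp only [negKilling, LinearMap.neg_apply, LieModule.traceForm_comm ℝ g g x y]

theorem negKilling_lie_swap (x y z : g) : negKilling g ⁅x, y⁆ z = -negKilling g ⁅y, x⁆ z := by
  rw [← lie_skew, map_neg, LinearMap.neg_apply]

theorem negKilling_lie_swap_right (x y z : g) :
    negKilling g ⁅x, y⁆ z = -negKilling g ⁅x, z⁆ y := by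
  rw [negKilling_lie, negKilling_comm]

variable {V : Fin 7 → Submodule ℝ g}
  (e : ∀ i, Module.Basis (Fin (Module.finrank ℝ (V i))) ℝ (V i))

theorem structureCoeff_swap_left (i j k : Fin 7) :
    structureCoeff e i j k = structureCoeff e j i k := by
  rw [structureCoeff, structureCoeff, Finset.sum_comm]
  refine Finset.sum_congr rfl fun b _ => Finset.sum_congr rfl fun a _ =>
    Finset.sum_congr rfl fun c _ => ?_
  rw [negKilling_lie_swap, neg_sq]

theorem structureCoeff_swap_right (i j k : Fin 7) :
    structureCoeff e i j k = structureCoeff e i k j := by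
  rw [structureCoeff, structureCoeff]
  refine Finset.sum_congr rfl fun a _ => ?_
  rw [Finset.sum_comm]
  refine Finset.sum_congr rfl fun c _ => Finset.sum_congr rfl fun b _ => ?_
  rw [negKilling_lie_swap_right, neg_sq]

theorem structureCoeff_nonneg (i j k : Fin 7) : 0 ≤ structureCoeff e i j k :=
  Finset.sum_nonneg fun _ _ => Finset.sum_nonneg fun _ _ => Finset.sum_nonneg fun _ _ =>
    sq_nonneg _

theorem structureCoeff_eq_zero {i j k : Fin 7}
    (h : ∀ x ∈ V i, ∀ y ∈ V j, ∀ z ∈ V k, negKilling g ⁅x, y⁆ z = 0) :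
    structureCoeff e i j k = 0 :=
  Finset.sum_eq_zero fun a _ => Finset.sum_eq_zero fun b _ => Finset.sum_eq_zero fun c _ => by
    rw [h _ (e i a).2 _ (e j b).2 _ (e k c).2, sq, mul_zero]

theorem sum_sum_structureCoeff (I : Finset (Fin 7)) (i : Fin 7) :
    ∑ j ∈ I, ∑ k ∈ I, structureCoeff e i j k = ∑ a, ∑ j ∈ I, ∑ b, ∑ k ∈ I, ∑ c,
      (negKilling g ⁅(e i a : g), (e j b : g)⁆ (e k c : g)) ^ 2 := by
  have h : ∀ j, ∑ k ∈ I, structureCoeff e i j k = ∑ a, ∑ b, ∑ k ∈ I, ∑ c,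
      (negKilling g ⁅(e i a : g), (e j b : g)⁆ (e k c : g)) ^ 2 := by
    intro j
    simp only [structureCoeff]
    rw [Finset.sum_comm]
    exact Finset.sum_congr rfl fun a _ => Finset.sum_comm
  rw [Finset.sum_congr rfl fun j _ => h j, Finset.sum_comm]

variable {e}

theorem negKilling_collectedBasis (hint : DirectSum.IsInternal V)
    (horth : ∀ i j, i ≠ j → ∀ x ∈ V i, ∀ y ∈ V j, negKilling g x y = 0)
    (he : IsNegKillingOrthonormal e) (p q : Σ i, Fin (Module.finrank ℝ (V i))) :
    negKilling g (hint.collectedBasis e p) (hint.collectedBasis e q) = if p = q then 1 else 0 := by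
  obtain ⟨i, a⟩ := p
  obtain ⟨j, b⟩ := q
  rw [DirectSum.IsInternal.collectedBasis_coe]
  by_cases hij : i = j
  · subst hij
    rw [he]
    simp
  · rw [if_neg (fun h => hij (congrArg Sigma.fst h)), horth i j hij _ (e i a).2 _ (e j b).2]

theorem sum_structureCoeff (hint : DirectSum.IsInternal V)
    (horth : ∀ i j, i ≠ j → ∀ x ∈ V i, ∀ y ∈ V j, negKilling g x y = 0)
    (he : IsNegKillingOrthonormal e) (i : Fin 7) :
    ∑ j, ∑ k, structureCoeff e i j k = Module.finrank ℝ (V i) := by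
  have h1 : ∀ a, ∑ j, ∑ b, ∑ k, ∑ c,
      (negKilling g ⁅(e i a : g), (e j b : g)⁆ (e k c : g)) ^ 2 = 1 := by
    intro a
    have h := neg_killingForm_apply_self (β := negKilling g) negKilling_lie
      (negKilling_collectedBasis hint horth he) (e i a : g)
    have h2 : -killingForm ℝ g (e i a : g) (e i a : g) = 1 := by
      have := he i a a
      rwa [if_pos rfl] at this
    rw [h2] at h
    rw [h]
    simp only [DirectSum.IsInternal.collectedBasis_coe, Fintype.sum_sigma]
  rw [sum_sum_structureCoeff, Finset.sum_congr rfl fun a _ => h1 a]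
  simp

/-- The basis of a subalgebra that is the sum of some of the summands. -/
theorem exists_basis_of_toSubmodule_eq (hint : DirectSum.IsInternal V) {I : Finset (Fin 7)}
    {s : LieSubalgebra ℝ g} (hs : s.toSubmodule = ⨆ i ∈ I, V i) :
    ∃ b : Module.Basis (Σ i : I, Fin (Module.finrank ℝ (V i))) ℝ s,
      ∀ p, (b p : g) = e p.1 p.2 := by
  have hle : ∀ i ∈ I, V i ≤ s.toSubmodule := fun i hi => hs ▸ le_biSup V hi
  let v : (Σ i : I, Fin (Module.finrank ℝ (V i))) → s :=
    fun p => ⟨e p.1 p.2, hle p.1 p.1.2 (e p.1 p.2).2⟩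
  have hli : LinearIndependent ℝ v := by
    apply LinearIndependent.of_comp s.toSubmodule.subtype
    have h := (hint.collectedBasis e).linearIndependent
    have h2 := h.comp (fun p : (Σ i : I, Fin (Module.finrank ℝ (V i))) =>
      (⟨p.1, p.2⟩ : Σ i, Fin (Module.finrank ℝ (V i)))) (by
        rintro ⟨⟨i, hi⟩, a⟩ ⟨⟨j, hj⟩, b⟩ hab
        simp only [Sigma.mk.injEq] at hab
        obtain ⟨rfl, hab⟩ := hab
        simpa using hab)
    have heq : s.toSubmodule.subtype ∘ v = hint.collectedBasis e ∘
        fun p : (Σ i : I, Fin (Module.finrank ℝ (V i))) =>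
          (⟨p.1, p.2⟩ : Σ i, Fin (Module.finrank ℝ (V i))) := by
      funext p
      simp [v, DirectSum.IsInternal.collectedBasis_coe]
    rw [heq]
    exact h2
  have hspan : ⊤ ≤ Submodule.span ℝ (Set.range v) := by
    rintro ⟨x, hx⟩ -
    have hVi : ∀ i : I, V i ≤ (Submodule.span ℝ (Set.range v)).map s.toSubmodule.subtype := by
      intro i
      have h1 : V i = (Submodule.span ℝ (Set.range (e i))).map (V i).subtype := by
        rw [(e i).span_eq, Submodule.map_top, Submodule.range_subtype]
      rw [h1, Submodule.map_span, Submodule.map_span]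
      apply Submodule.span_mono
      rintro _ ⟨_, ⟨a, rfl⟩, rfl⟩
      exact ⟨v ⟨i, a⟩, ⟨_, rfl⟩, rfl⟩
    have hx' : x ∈ ⨆ i ∈ I, V i := hs ▸ hx
    have h2 := (iSup₂_le fun i hi => hVi ⟨i, hi⟩ :
      ⨆ i ∈ I, V i ≤ (Submodule.span ℝ (Set.range v)).map s.toSubmodule.subtype) hx'
    obtain ⟨y, hy, hyx⟩ := h2
    have : y = ⟨x, hx⟩ := Subtype.ext hyx
    rwa [this] at hy
  exact ⟨Module.Basis.mk hli hspan, fun p => by rw [Module.Basis.mk_apply]⟩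

/-- The consequences for the structure coefficients of the presence of a subalgebra `su(n)` that
is the sum of some of the summands. -/
theorem exists_ratio_of_isSuSubalgebra (hint : DirectSum.IsInternal V)
    (horth : ∀ i j, i ≠ j → ∀ x ∈ V i, ∀ y ∈ V j, negKilling g x y = 0)
    (he : IsNegKillingOrthonormal e) {I : Finset (Fin 7)} {n : ℕ} (hn : 2 ≤ n)
    (hsu : IsSuSubalgebra (⨆ i ∈ I, V i) n) :
    ∃ r : ℝ, (∀ i ∈ I, ∑ j ∈ I, ∑ k ∈ I, structureCoeff e i j k = r * Module.finrank ℝ (V i)) ∧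
      (∃ h ∈ ⨆ i ∈ I, V i, ∃ x ∈ ⨆ i ∈ I, V i, ∃ y ∈ ⨆ i ∈ I, V i,
        IsSuTwoTriple h x y ∧ r * negKilling g h h = 4 * n) ∧
      (∀ h ∈ ⨆ i ∈ I, V i, ∀ x ∈ ⨆ i ∈ I, V i, ∀ y ∈ ⨆ i ∈ I, V i,
        IsSuTwoTriple h x y → 4 * n ≤ r * negKilling g h h) ∧
      ∑ i ∈ I, Module.finrank ℝ (V i) + 1 = n * n := by
  obtain ⟨s, hs, ⟨φ⟩⟩ := hsu
  obtain ⟨b, hb⟩ := exists_basis_of_toSubmodule_eq (e := e) hint hs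
  let β : LinearMap.BilinForm ℝ s :=
    (negKilling g).compl₁₂ s.toSubmodule.subtype s.toSubmodule.subtype
  have hβ : ∀ x y : s, β x y = negKilling g (x : g) (y : g) := fun _ _ => rfl
  have hbb : ∀ p q, β (b p) (b q) = if p = q then 1 else 0 := by
    rintro ⟨i, a⟩ ⟨j, c⟩
    rw [hβ, hb, hb]
    by_cases hij : i = j
    · subst hij
      rw [he]
      simp
    · rw [if_neg (fun h => hij (congrArg Sigma.fst h)),
        horth i j (fun h => hij (Subtype.ext h)) _ (e i a).2 _ (e j c).2]
  obtain ⟨r, hr1, ⟨h, x, y, t, ht⟩, hr3⟩ := exists_killingForm_ratio hn φ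
    (fun x y z : s => negKilling_lie (x : g) y z) hbb
  have hmem : ∀ x : g, x ∈ ⨆ i ∈ I, V i ↔ x ∈ s := fun x => by rw [← hs]; rfl
  refine ⟨r, fun i hi => ?_, ?_, ?_, ?_⟩
  · have h1 : ∀ a, ∑ j ∈ I, ∑ b, ∑ k ∈ I, ∑ c,
        (negKilling g ⁅(e i a : g), (e j b : g)⁆ (e k c : g)) ^ 2 = r := by
      intro a
      have h := hr1 (b ⟨⟨i, hi⟩, a⟩)
      rw [hbb, if_pos rfl, mul_one] at h
      rw [← h]
      simp only [hβ, LieSubalgebra.coe_bracket, hb, Fintype.sum_sigma]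
      rw [← Finset.sum_coe_sort I]
      refine Finset.sum_congr rfl fun j _ => Finset.sum_congr rfl fun c _ => ?_
      rw [← Finset.sum_coe_sort I]
    rw [sum_sum_structureCoeff, Finset.sum_congr rfl fun a _ => h1 a]
    simp [mul_comm]
  · exact ⟨h, (hmem _).2 h.2, x, (hmem _).2 x.2, y, (hmem _).2 y.2,
      t.map s.incl Subtype.val_injective, ht⟩
  · intro h hh x hx y hy t
    refine hr3 ⟨h, (hmem _).1 hh⟩ ⟨x, (hmem _).1 hx⟩ ⟨y, (hmem _).1 hy⟩
      ⟨fun h0 => t.h_ne_zero (congrArg Subtype.val h0), Subtype.ext t.lie_h_x,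
        Subtype.ext t.lie_h_y, Subtype.ext t.lie_x_y⟩
  · have hn0 : NeZero n := ⟨by lia⟩
    rw [← finrank_suLie n, ← φ.toLinearEquiv.finrank_eq, Module.finrank_eq_card_basis b]
    simp [Finset.sum_attach I (fun i => Module.finrank ℝ (V i))]

end NegKilling

/-! ### Selection rules for `E₆`-II -/

/-- The summands that may occur in the bracket of two given summands of an `E₆`-II
decomposition. -/
def bracketSupport (i j : Fin 7) : Finset (Fin 7) :=
  if i ≤ 3 then
    if j ≤ 3 then if i = j ∧ i ≠ 0 then {i} else ∅ else {j}
  else if j ≤ 3 then {i}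
  else if i = j then {0, 1, 2, 3}
  else Finset.univ.filter fun l => 4 ≤ l ∧ l ≠ i ∧ l ≠ j

/-- The index triples of the possibly nonzero structure coefficients of an `E₆`-II
decomposition. -/
def e6IITriples : Finset (Multiset (Fin 7)) :=
  {{0, 4, 4}, {0, 5, 5}, {0, 6, 6}, {4, 5, 6},
    {1, 1, 1}, {1, 4, 4}, {1, 5, 5}, {1, 6, 6},
    {2, 2, 2}, {2, 4, 4}, {2, 5, 5}, {2, 6, 6},
    {3, 3, 3}, {3, 4, 4}, {3, 5, 5}, {3, 6, 6}}

theorem notMem_bracketSupport_of_notMem_e6IITriples : ∀ i j k : Fin 7,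
    ({i, j, k} : Multiset (Fin 7)) ∉ e6IITriples →
      k ∉ bracketSupport i j ∨ j ∉ bracketSupport i k ∨ i ∉ bracketSupport j k := by
  decide +kernel

section

variable {g : Type*} [LieRing g] [LieAlgebra ℝ g] {V : Fin 7 → Submodule ℝ g}

theorem isotropyPart_eq : isotropyPart V = ⨆ i ∈ ({0, 1, 2, 3} : Finset (Fin 7)), V i := by
  simp only [isotropyPart, Finset.mem_insert, Finset.mem_singleton, iSup_or, iSup_sup_eq,
    iSup_iSup_eq_left, sup_assoc]

theorem iSup_typeA5 : ⨆ i ∈ ({0, 2, 3, 4} : Finset (Fin 7)), V i = V 0 ⊔ V 2 ⊔ V 3 ⊔ V 4 := by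
  simp only [Finset.mem_insert, Finset.mem_singleton, iSup_or, iSup_sup_eq, iSup_iSup_eq_left,
    sup_assoc]

theorem iSup_typeA5' : ⨆ i ∈ ({0, 1, 3, 5} : Finset (Fin 7)), V i = V 0 ⊔ V 1 ⊔ V 3 ⊔ V 5 := by
  simp only [Finset.mem_insert, Finset.mem_singleton, iSup_or, iSup_sup_eq, iSup_iSup_eq_left,
    sup_assoc]

theorem IsNegKillingOrthonormal.restrict
    {e : ∀ i, Module.Basis (Fin (Module.finrank ℝ (V i))) ℝ (V i)}
    (he : IsNegKillingOrthonormal e) (i : Fin 7) (a b) :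
    (negKilling g).compl₁₂ (V i).subtype (V i).subtype (e i a) (e i b) =
      if a = b then 1 else 0 := by
  rw [LinearMap.compl₁₂_apply]
  exact he i a b

theorem le_isotropyPart {i : Fin 7} (hi : i ≤ 3) : V i ≤ isotropyPart V := by
  rw [isotropyPart_eq]
  have h : i ∈ ({0, 1, 2, 3} : Finset (Fin 7)) := by revert i; decide
  exact le_biSup V h

theorem IsNegKillingOrthonormal.repr_eq
    {e : ∀ i, Module.Basis (Fin (Module.finrank ℝ (V i))) ℝ (V i)}
    (he : IsNegKillingOrthonormal e) {i : Fin 7} (x : V i) (a) :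
    (e i).repr x a = negKilling g (x : g) (e i a : g) := by
  rw [repr_eq_of_orthonormal (he.restrict i), LinearMap.compl₁₂_apply]
  rfl

theorem IsSuSubalgebra.lie_mem {W : Submodule ℝ g}
    {n : ℕ} (h : IsSuSubalgebra W n) {x y : g} (hx : x ∈ W) (hy : y ∈ W) : ⁅x, y⁆ ∈ W := by
  obtain ⟨s, rfl, -⟩ := h
  exact s.lie_mem hx hy

end

namespace IsE6II

variable {g : Type*} [LieRing g] [LieAlgebra ℝ g] [FiniteDimensional ℝ g]
  {V : Fin 7 → Submodule ℝ g}

theorem lie_mem_bracketSupport (hV : IsE6II V) (i j : Fin 7) {x y : g} (hx : x ∈ V i)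
    (hy : y ∈ V j) : ⁅x, y⁆ ∈ ⨆ l ∈ bracketSupport i j, V l := by
  have hcases : ∀ i : Fin 7, i ≤ 3 → i = 0 ∨ i = 1 ∨ i = 2 ∨ i = 3 := by decide
  have hlt : ∀ i : Fin 7, ¬ i ≤ 3 → 4 ≤ i := by decide
  have hT : ∀ j : Fin 7, j ≤ 3 → ∀ x ∈ V 0, ∀ y ∈ V j, ⁅x, y⁆ = 0 :=
    fun j hj x hx y hy => hV.T_central x hx y (le_isotropyPart hj hy)
  have hcomm : ∀ {i j : Fin 7}, (∀ x ∈ V i, ∀ y ∈ V j, ⁅x, y⁆ = 0) →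
      ∀ x ∈ V j, ∀ y ∈ V i, ⁅x, y⁆ = 0 := by
    intro i j h x hx y hy
    rw [← lie_skew, h y hy x hx, neg_zero]
  by_cases hi : i ≤ 3 <;> by_cases hj : j ≤ 3
  · by_cases hij : i = j ∧ i ≠ 0
    · rw [bracketSupport, if_pos hi, if_pos hj, if_pos hij]
      obtain ⟨rfl, h0⟩ := hij
      simp only [Finset.mem_singleton, iSup_iSup_eq_left]
      rcases hcases i hi with rfl | rfl | rfl | rfl
      · exact absurd rfl h0
      · exact IsSuSubalgebra.lie_mem hV.typeA1 hx hy
      · exact IsSuSubalgebra.lie_mem hV.typeA1' hx hy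
      · exact IsSuSubalgebra.lie_mem hV.typeA3 hx hy
    · have h0 : ⁅x, y⁆ = 0 := by
        rcases hcases i hi with rfl | rfl | rfl | rfl
        · exact hT j hj x hx y hy
        all_goals rcases hcases j hj with rfl | rfl | rfl | rfl
        all_goals first
          | exact absurd ⟨rfl, by decide⟩ hij
          | exact hcomm (hT _ (by decide)) x hx y hy
          | exact hV.lie_12 x hx y hy
          | exact hV.lie_13 x hx y hy
          | exact hV.lie_23 x hx y hy
          | exact hcomm hV.lie_12 x hx y hy
          | exact hcomm hV.lie_13 x hx y hy
          | exact hcomm hV.lie_23 x hx y hy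
      rw [h0]
      exact zero_mem _
  · rw [bracketSupport, if_pos hi, if_neg hj]
    simp only [Finset.mem_singleton, iSup_iSup_eq_left]
    exact (hV.irreducible j (hlt j hj)).2.1 x (le_isotropyPart hi hx) y hy
  · rw [bracketSupport, if_neg hi, if_pos hj]
    simp only [Finset.mem_singleton, iSup_iSup_eq_left]
    rw [← lie_skew]
    exact neg_mem ((hV.irreducible i (hlt i hi)).2.1 y (le_isotropyPart hj hy) x hx)
  · by_cases hij : i = j
    · subst hij
      rw [bracketSupport, if_neg hi, if_neg hj, if_pos rfl, ← isotropyPart_eq]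
      exact hV.lie_self_mem i (hlt i hi) x hx y hy
    · rw [bracketSupport, if_neg hi, if_neg hj, if_neg hij]
      obtain ⟨l, hl, hl1, hl2⟩ : ∃ l : Fin 7, 4 ≤ l ∧ l ≠ i ∧ l ≠ j := by
        clear hx hy
        revert i j
        decide
      have hmem := hV.lie_mem i j l (hlt i hi) (hlt j hj) hl hij hl1.symm hl2.symm x hx y hy
      exact le_biSup V (Finset.mem_filter.2 ⟨Finset.mem_univ l, hl, hl1, hl2⟩) hmem

theorem negKilling_eq_zero_of_mem_iSup (hV : IsE6II V) {I : Finset (Fin 7)} {k : Fin 7}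
    (hk : k ∉ I) {x z : g} (hx : x ∈ ⨆ l ∈ I, V l) (hz : z ∈ V k) : negKilling g x z = 0 := by
  have hle : ⨆ l ∈ I, V l ≤ LinearMap.ker ((negKilling g).flip z) :=
    iSup₂_le fun l hl y hy => hV.orthogonal l k (fun h => hk (h ▸ hl)) y hy z hz
  exact hle hx

variable (e : ∀ i, Module.Basis (Fin (Module.finrank ℝ (V i))) ℝ (V i))

theorem structureCoeff_eq_zero_of_lie_mem (hV : IsE6II V) {I : Finset (Fin 7)} {i j k : Fin 7}
    (hk : k ∉ I) (h : ∀ x ∈ V i, ∀ y ∈ V j, ⁅x, y⁆ ∈ ⨆ l ∈ I, V l) :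
    structureCoeff e i j k = 0 :=
  structureCoeff_eq_zero e fun x hx y hy _ hz =>
    hV.negKilling_eq_zero_of_mem_iSup hk (h x hx y hy) hz

theorem structureCoeff_eq_zero_of_bracketSupport (hV : IsE6II V) {i j k : Fin 7}
    (h : k ∉ bracketSupport i j ∨ j ∉ bracketSupport i k ∨ i ∉ bracketSupport j k) :
    structureCoeff e i j k = 0 := by
  have aux : ∀ i j k : Fin 7, k ∉ bracketSupport i j → structureCoeff e i j k = 0 :=
    fun i j k hk => hV.structureCoeff_eq_zero_of_lie_mem e hk
      fun x hx y hy => hV.lie_mem_bracketSupport i j hx hy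
  rcases h with h | h | h
  · exact aux i j k h
  · rw [structureCoeff_swap_right]
    exact aux i k j h
  · rw [structureCoeff_swap_left, structureCoeff_swap_right]
    exact aux j k i h

theorem structureCoeff_eq_zero_of_notMem (hV : IsE6II V) {i j k : Fin 7}
    (h : ({i, j, k} : Multiset (Fin 7)) ∉ e6IITriples) : structureCoeff e i j k = 0 :=
  hV.structureCoeff_eq_zero_of_bracketSupport e
    (notMem_bracketSupport_of_notMem_e6IITriples i j k h)

/-- `[p₁, p₁]` lies in the first `A₅`, which is orthogonal to `A₁¹`. -/
theorem structureCoeff_one_four_four (hV : IsE6II V) : structureCoeff e 1 4 4 = 0 := by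
  rw [structureCoeff_swap_left, structureCoeff_swap_right]
  refine hV.structureCoeff_eq_zero_of_lie_mem e (I := {0, 2, 3, 4}) (by decide) fun x hx y hy => ?_
  have hle : V 4 ≤ ⨆ i ∈ ({0, 2, 3, 4} : Finset (Fin 7)), V i := le_biSup V (by decide)
  exact IsSuSubalgebra.lie_mem (iSup_typeA5 (V := V) ▸ hV.typeA5) (hle hx) (hle hy)

theorem structureCoeff_two_five_five (hV : IsE6II V) : structureCoeff e 2 5 5 = 0 := by
  rw [structureCoeff_swap_left, structureCoeff_swap_right]
  refine hV.structureCoeff_eq_zero_of_lie_mem e (I := {0, 1, 3, 5}) (by decide) fun x hx y hy => ?_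
  have hle : V 5 ≤ ⨆ i ∈ ({0, 1, 3, 5} : Finset (Fin 7)), V i := le_biSup V (by decide)
  exact IsSuSubalgebra.lie_mem (iSup_typeA5' (V := V) ▸ hV.typeA5') (hle hx) (hle hy)

/-! ### The action of the center `T` on the isotropy summands -/

variable {e}

/-- The square of an element of `T` acts on each isotropy summand as a scalar. -/
theorem exists_lie_lie_eq_smul (hV : IsE6II V) (he : IsNegKillingOrthonormal e) {t : g}
    (ht : t ∈ V 0) {i : Fin 7} (hi : 4 ≤ i) : ∃ μ : ℝ, ∀ x ∈ V i, ⁅t, ⁅t, x⁆⁆ = μ • x := by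
  obtain ⟨hbot, hstab, hirr⟩ := hV.irreducible i hi
  have htk : t ∈ isotropyPart V := le_isotropyPart (by decide) ht
  -- The matrix of `(ad t)²` on `V i` is symmetric, so it has a real eigenvector. As `t` commutes
  -- with `k`, the eigenspace is a submodule, and irreducibility makes it all of `V i`.
  let M : Matrix (Fin (Module.finrank ℝ (V i))) (Fin (Module.finrank ℝ (V i))) ℝ :=
    Matrix.of fun a b => negKilling g ⁅t, ⁅t, (e i b : g)⁆⁆ (e i a)
  have hM : M.IsHermitian := by
    ext a b
    simp only [M, Matrix.conjTranspose_apply, Matrix.of_apply, star_trivial]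
    rw [negKilling_lie, negKilling_lie, neg_neg, negKilling_comm]
  have hne : Nonempty (Fin (Module.finrank ℝ (V i))) := by
    by_contra hcon
    rw [not_nonempty_iff] at hcon
    have := (e i).repr.toEquiv.subsingleton
    exact hbot (Submodule.subsingleton_iff_eq_bot.1 this)
  obtain ⟨a0⟩ := hne
  set v : Fin (Module.finrank ℝ (V i)) → ℝ := (hM.eigenvectorBasis a0).ofLp with hv
  have hMv : M.mulVec v = hM.eigenvalues a0 • v := hM.mulVec_eigenvectorBasis a0
  have hv0 : v ≠ 0 := by
    intro h
    apply hM.eigenvectorBasis.orthonormal.ne_zero a0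
    ext k
    exact congrFun h k
  refine ⟨hM.eigenvalues a0, ?_⟩
  set μ := hM.eigenvalues a0
  let U : Submodule ℝ g := V i ⊓ LinearMap.ker
    (LieAlgebra.ad ℝ g t ∘ₗ LieAlgebra.ad ℝ g t - μ • LinearMap.id)
  have hU : ∀ x, x ∈ U ↔ x ∈ V i ∧ ⁅t, ⁅t, x⁆⁆ = μ • x := by
    intro x
    simp [U, sub_eq_zero]
  have hUV : U = ⊥ ∨ U = V i := by
    refine hirr U inf_le_left fun k hk u hu => ?_
    rw [hU] at hu ⊢
    refine ⟨hstab k hk u hu.1, ?_⟩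
    have hc : ∀ w : g, ⁅t, ⁅k, w⁆⁆ = ⁅k, ⁅t, w⁆⁆ := by
      intro w
      rw [leibniz_lie, hV.T_central t ht k hk, zero_lie, zero_add]
    rw [hc, hc, hu.2, lie_smul]
  rcases hUV with h | h
  · exfalso
    apply hv0
    set x : V i := (e i).equivFun.symm v with hx
    have hxrepr : ∀ b, (e i).repr x b = v b := fun b => by
      simp [hx, Module.Basis.equivFun_symm_apply, Finsupp.single_apply]
    have hxsum : (x : g) = ∑ b, v b • (e i b : g) := by
      rw [hx, Module.Basis.equivFun_symm_apply]
      simp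
    have hxU : (x : g) ∈ U := by
      rw [hU]
      refine ⟨x.2, ?_⟩
      let z : V i := ⟨⁅t, ⁅t, (x : g)⁆⁆, hstab t htk _ (hstab t htk _ x.2)⟩
      have hz : z = μ • x := by
        apply (e i).repr.injective
        ext a
        rw [he.repr_eq, map_smul, Finsupp.smul_apply, hxrepr, ← Pi.smul_apply, ← hMv]
        simp only [z, hxsum, lie_sum, lie_smul, map_sum, map_smul, LinearMap.sum_apply,
          LinearMap.smul_apply, Matrix.mulVec, dotProduct, M, Matrix.of_apply, smul_eq_mul]
        exact Finset.sum_congr rfl fun b _ => mul_comm _ _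
      exact congrArg Subtype.val hz
    rw [h, Submodule.mem_bot] at hxU
    have hx0 : x = 0 := Subtype.ext hxU
    funext b
    rw [← hxrepr, hx0]
    simp
  · intro x hx
    rw [← h, hU] at hx
    exact hx.2

/-- For the unit vector `t` of the line `T`, each basis vector `b` of `V i` contributes `B([t, b],
[t, b]) = -μ`. -/
theorem exists_central_unit (hV : IsE6II V) (he : IsNegKillingOrthonormal e) :
    ∃ t ∈ V 0, ∀ i, 4 ≤ i → ∀ μ : ℝ, (∀ x ∈ V i, ⁅t, ⁅t, x⁆⁆ = μ • x) →
      structureCoeff e 0 i i = -μ * Module.finrank ℝ (V i) := by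
  have hcard : (Finset.univ : Finset (Fin (Module.finrank ℝ (V 0)))).card = 1 := by
    rw [Finset.card_univ, Fintype.card_fin, hV.finrank_T]
  obtain ⟨a0, ha0⟩ := Finset.card_eq_one.1 hcard
  refine ⟨e 0 a0, (e 0 a0).2, fun i hi μ hμ => ?_⟩
  rw [structureCoeff, ha0, Finset.sum_singleton]
  have h1 : ∀ b, ∑ c, negKilling g ⁅(e 0 a0 : g), (e i b : g)⁆ (e i c) ^ 2 = -μ := by
    intro b
    have hmem : ⁅(e 0 a0 : g), (e i b : g)⁆ ∈ V i := (hV.irreducible i hi).2.1 _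
      (le_isotropyPart (by decide) (e 0 a0).2) _ (e i b).2
    have h := apply_self_eq_sum_sq (he.restrict i) ⟨_, hmem⟩
    simp only [LinearMap.compl₁₂_apply, Submodule.subtype_apply] at h
    rw [← h]
    rw [negKilling_lie, hμ _ (e i b).2, map_smul, he i b b, if_pos rfl, smul_eq_mul, mul_one]
  rw [Finset.sum_congr rfl fun b _ => h1 b]
  simp [mul_comm]

end IsE6II

/-- If the square of a derivation `ad t` acts as `μ` on `x` and on `y` and as `ν` on the brackets
`⁅x, y⁆` and `⁅⁅t, x⁆, ⁅t, y⁆⁆`, where `⁅x, y⁆ ≠ 0`, then `ν = 0` or `ν = 4μ`. -/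
theorem eq_zero_or_eq_four_mul_of_lie_lie {g : Type*} [LieRing g] [LieAlgebra ℝ g] {t x y : g}
    {μ ν : ℝ} (hx : ⁅t, ⁅t, x⁆⁆ = μ • x) (hy : ⁅t, ⁅t, y⁆⁆ = μ • y)
    (hxy : ⁅t, ⁅t, ⁅x, y⁆⁆⁆ = ν • ⁅x, y⁆)
    (htxy : ⁅t, ⁅t, ⁅⁅t, x⁆, ⁅t, y⁆⁆⁆⁆ = ν • ⁅⁅t, x⁆, ⁅t, y⁆⁆) (hne : ⁅x, y⁆ ≠ 0) :
    ν = 0 ∨ ν = 4 * μ := by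
  have key : ∀ a b : g, ⁅t, ⁅t, ⁅a, b⁆⁆⁆ =
      ⁅⁅t, ⁅t, a⁆⁆, b⁆ + (2 : ℝ) • ⁅⁅t, a⁆, ⁅t, b⁆⁆ + ⁅a, ⁅t, ⁅t, b⁆⁆⁆ := by
    intro a b
    rw [leibniz_lie t a b, lie_add, leibniz_lie t ⁅t, a⁆ b, leibniz_lie t a ⁅t, b⁆]
    module
  rw [key, hx, hy, smul_lie, lie_smul] at hxy
  rw [key, hx, hy, lie_smul, lie_smul, smul_lie, smul_lie, lie_smul, lie_smul] at htxy
  -- Applying `h1` and then `h2` gives `(ν - 2μ)² = 4μ²` on `⁅x, y⁆`.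
  have h1 : (ν - 2 * μ) • ⁅x, y⁆ = (2 : ℝ) • ⁅⁅t, x⁆, ⁅t, y⁆⁆ := by
    linear_combination (norm := module) (-1 : ℝ) • hxy
  have h2 : (ν - 2 * μ) • ⁅⁅t, x⁆, ⁅t, y⁆⁆ = (2 * μ ^ 2) • ⁅x, y⁆ := by
    linear_combination (norm := module) (-1 : ℝ) • htxy
  have h3 : (ν * (ν - 4 * μ)) • ⁅x, y⁆ = 0 := by
    linear_combination (norm := module) (ν - 2 * μ) • h1 + (2 : ℝ) • h2
  rcases mul_eq_zero.1 ((smul_eq_zero.1 h3).resolve_right hne) with h | h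
  · exact Or.inl h
  · exact Or.inr (by linarith)

/-- The discriminant is `16·217`, not a square. The polynomial is that of `z = 72γ = 60 - dim p₃` in
the case `(066) ≠ 0`. -/
theorem int_quadratic_ne_zero (z : ℤ) : z ^ 2 - 68 * z + 288 ≠ 0 := by
  intro h
  have h1 : 4 ≤ z := by nlinarith
  have h2 : z ≤ 64 := by nlinarith
  interval_cases z <;> lia

namespace IsE6II

variable {g : Type*} [LieRing g] [LieAlgebra ℝ g] [FiniteDimensional ℝ g]
  {V : Fin 7 → Submodule ℝ g} {e : ∀ i, Module.Basis (Fin (Module.finrank ℝ (V i))) ℝ (V i)}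

/-- If `ad t` has eigenvalues `±ia` on both `p₁` and `p₂`, then on `p₃`, which meets `[p₁, p₂]`
nontrivially, its square is `0` or `-4a²`. Equal coefficients and equal dimensions give `p₁` and
`p₂` the same `a`. -/
theorem structureCoeff_zero_six_six (hV : IsE6II V) (he : IsNegKillingOrthonormal e)
    (h45 : structureCoeff e 0 4 4 = structureCoeff e 0 5 5)
    (hd4 : Module.finrank ℝ (V 4) = 16) (hd5 : Module.finrank ℝ (V 5) = 16)
    (hne : structureCoeff e 4 5 6 ≠ 0) :
    structureCoeff e 0 6 6 = 0 ∨
      structureCoeff e 0 6 6 = structureCoeff e 0 4 4 / 4 * Module.finrank ℝ (V 6) := by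
  obtain ⟨t, ht, htc⟩ := hV.exists_central_unit he
  obtain ⟨μ₄, hμ₄⟩ := hV.exists_lie_lie_eq_smul he ht (i := 4) (by decide)
  obtain ⟨μ₅, hμ₅⟩ := hV.exists_lie_lie_eq_smul he ht (i := 5) (by decide)
  obtain ⟨ν, hν⟩ := hV.exists_lie_lie_eq_smul he ht (i := 6) (by decide)
  have e4 := htc 4 (by decide) μ₄ hμ₄
  have e5 := htc 5 (by decide) μ₅ hμ₅
  have e6 := htc 6 (by decide) ν hν
  rw [hd4] at e4
  rw [hd5] at e5
  push_cast at e4 e5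
  obtain rfl : μ₄ = μ₅ := by linarith
  obtain ⟨x, hx, y, hy, hxy⟩ : ∃ x ∈ V 4, ∃ y ∈ V 5, ⁅x, y⁆ ≠ 0 := by
    by_contra! hcon
    refine hne (structureCoeff_eq_zero e fun x hx y hy z _ => ?_)
    rw [hcon x hx y hy, map_zero, LinearMap.zero_apply]
  have hbr : ∀ x ∈ V 4, ∀ y ∈ V 5, ⁅x, y⁆ ∈ V 6 :=
    hV.lie_mem 4 5 6 (by decide) (by decide) (by decide) (by decide) (by decide) (by decide)
  have htk := le_isotropyPart (V := V) (show (0 : Fin 7) ≤ 3 by decide) ht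
  have h := eq_zero_or_eq_four_mul_of_lie_lie (hμ₄ x hx) (hμ₅ y hy) (hν _ (hbr x hx y hy))
    (hν _ (hbr _ ((hV.irreducible 4 (by decide)).2.1 t htk x hx) _
      ((hV.irreducible 5 (by decide)).2.1 t htk y hy))) hxy
  rcases h with h | h
  · left
    rw [e6, h, neg_zero, zero_mul]
  · right
    rw [e6, e4, h]
    ring

end IsE6II

/-- The ratios of the invariant forms on the subalgebras of type `A` determine all coefficients up
to one parameter `γ`, in terms of which `dim p₃ = 60 - 72γ`. The action of `T` on `p₃`, on which
its square is a scalar, leaves only `γ = 1/2`, since `dim p₃` is an integer. Of the hypotheses on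
`g` itself, only the positivity of `B` is needed. -/
theorem lemma3p6 {g : Type*} [LieRing g] [LieAlgebra ℝ g] [FiniteDimensional ℝ g]
    (V : Fin 7 → Submodule ℝ g) (hV : IsE6II V)
    (e : ∀ i, Module.Basis (Fin (Module.finrank ℝ (V i))) ℝ (V i))
    (he : IsNegKillingOrthonormal e) :
    (structureCoeff e 0 4 4 = 1 / 2 ∧ structureCoeff e 0 5 5 = 1 / 2 ∧
      structureCoeff e 0 6 6 = 0 ∧ structureCoeff e 4 5 6 = 4) ∧
    (structureCoeff e 1 1 1 = 1 / 2 ∧ structureCoeff e 1 4 4 = 0 ∧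
      structureCoeff e 1 5 5 = 1 ∧ structureCoeff e 1 6 6 = 3 / 2) ∧
    (structureCoeff e 2 2 2 = 1 / 2 ∧ structureCoeff e 2 4 4 = 1 ∧
      structureCoeff e 2 5 5 = 0 ∧ structureCoeff e 2 6 6 = 3 / 2) ∧
    (structureCoeff e 3 3 3 = 5 ∧ structureCoeff e 3 4 4 = 5 / 2 ∧
      structureCoeff e 3 5 5 = 5 / 2 ∧ structureCoeff e 3 6 6 = 5) ∧
    -- all the other coefficients vanish
    (∀ i j k : Fin 7,
      ({i, j, k} : Multiset (Fin 7)) ∉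
        ({{0, 4, 4}, {0, 5, 5}, {0, 6, 6}, {4, 5, 6},
          {1, 1, 1}, {1, 4, 4}, {1, 5, 5}, {1, 6, 6},
          {2, 2, 2}, {2, 4, 4}, {2, 5, 5}, {2, 6, 6},
          {3, 3, 3}, {3, 4, 4}, {3, 5, 5}, {3, 6, 6}} : Set (Multiset (Fin 7))) →
      structureCoeff e i j k = 0) := by
  have hz : ∀ i j k : Fin 7,
      (k ∉ bracketSupport i j ∨ j ∉ bracketSupport i k ∨ i ∉ bracketSupport j k) →
      structureCoeff e i j k = 0 := fun i j k => hV.structureCoeff_eq_zero_of_bracketSupport e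
  have h12 := structureCoeff_swap_left e
  have h23 := structureCoeff_swap_right e
  have hA : ∀ l m, structureCoeff e m l m = structureCoeff e l m m := fun l m => h12 m l m
  have hB : ∀ l m, structureCoeff e m m l = structureCoeff e l m m :=
    fun l m => (h23 m m l).trans (h12 m l m)
  have h144 := hV.structureCoeff_one_four_four e
  have h255 := hV.structureCoeff_two_five_five e
  have n066 := structureCoeff_nonneg e 0 6 6
  have K := sum_structureCoeff hV.isInternal hV.orthogonal he
  have K0 := K 0
  have K1 := K 1
  have K2 := K 2
  have K3 := K 3
  have K4 := K 4
  have K6 := K 6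
  clear K
  have S1 : IsSuSubalgebra (⨆ i ∈ ({1} : Finset (Fin 7)), V i) 2 := by simpa using hV.typeA1
  have S2 : IsSuSubalgebra (⨆ i ∈ ({2} : Finset (Fin 7)), V i) 2 := by simpa using hV.typeA1'
  have S3 : IsSuSubalgebra (⨆ i ∈ ({3} : Finset (Fin 7)), V i) 4 := by simpa using hV.typeA3
  obtain ⟨r₁, R1, T1, -, D1⟩ :=
    exists_ratio_of_isSuSubalgebra hV.isInternal hV.orthogonal he (by norm_num) S1
  obtain ⟨r₂, R2, T2, -, D2⟩ :=
    exists_ratio_of_isSuSubalgebra hV.isInternal hV.orthogonal he (by norm_num) S2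
  obtain ⟨r₃, R3, T3, -, D3⟩ :=
    exists_ratio_of_isSuSubalgebra hV.isInternal hV.orthogonal he (by norm_num) S3
  obtain ⟨γ, R5, -, T5, D5⟩ := exists_ratio_of_isSuSubalgebra hV.isInternal hV.orthogonal he
    (by norm_num) (iSup_typeA5 (V := V) ▸ hV.typeA5)
  obtain ⟨γ', R5', -, T5', D5'⟩ := exists_ratio_of_isSuSubalgebra hV.isInternal hV.orthogonal he
    (by norm_num) (iSup_typeA5' (V := V) ▸ hV.typeA5')
  have D0 := hV.finrank_T
  replace D1 : Module.finrank ℝ (V 1) = 3 := by simpa using D1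
  replace D2 : Module.finrank ℝ (V 2) = 3 := by simpa using D2
  replace D3 : Module.finrank ℝ (V 3) = 15 := by simpa using D3
  replace D5 : Module.finrank ℝ (V 4) = 16 := by
    simp [D0, D2, D3] at D5
    lia
  replace D5' : Module.finrank ℝ (V 5) = 16 := by
    simp [D0, D1, D3] at D5'
    lia
  -- an `su(2)`-triple in one of the smaller subalgebras bounds the ratio of the factors
  have bound : ∀ {I J : Finset (Fin 7)} {r s : ℝ} {m n : ℕ}, I ⊆ J →
      (∃ h ∈ ⨆ i ∈ I, V i, ∃ x ∈ ⨆ i ∈ I, V i, ∃ y ∈ ⨆ i ∈ I, V i,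
        IsSuTwoTriple h x y ∧ r * negKilling g h h = 4 * m) →
      (∀ h ∈ ⨆ i ∈ J, V i, ∀ x ∈ ⨆ i ∈ J, V i, ∀ y ∈ ⨆ i ∈ J, V i,
        IsSuTwoTriple h x y → 4 * n ≤ s * negKilling g h h) → n * r ≤ m * s := by
    rintro I J r s m n hIJ ⟨h, hh, x, hx, y, hy, t, ht⟩ hJ
    have hle : ⨆ i ∈ I, V i ≤ ⨆ i ∈ J, V i := biSup_mono fun i hi => hIJ hi
    have h1 := hJ h (hle hh) x (hle hx) y (hle hy) t
    have hpos := hV.compactE6.1 h t.h_ne_zero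
    refine le_of_mul_le_mul_right ?_ hpos
    have h2 : (m : ℝ) * (4 * n) ≤ m * (s * negKilling g h h) :=
      mul_le_mul_of_nonneg_left h1 (Nat.cast_nonneg m)
    calc n * r * negKilling g h h = n * (r * negKilling g h h) := by ring
      _ = m * (4 * n) := by rw [ht]; ring
      _ ≤ m * s * negKilling g h h := by linarith
  have B1 := bound (by decide) T1 T5'
  have B2 := bound (by decide) T2 T5
  have B3 := bound (by decide) T3 T5
  have B3' := bound (by decide) T3 T5'
  clear bound T1 T2 T3 T5 T5'
  have Q1 := R1 1 (by decide)
  have Q2 := R2 2 (by decide)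
  have Q3 := R3 3 (by decide)
  have P0 := R5 0 (by decide)
  have P2 := R5 2 (by decide)
  have P3 := R5 3 (by decide)
  have P4 := R5 4 (by decide)
  have P0' := R5' 0 (by decide)
  have P1' := R5' 1 (by decide)
  have P3' := R5' 3 (by decide)
  have P5' := R5' 5 (by decide)
  clear R1 R2 R3 R5 R5'
  have I5 : ∀ f : Fin 7 → ℝ, ∑ j ∈ ({0, 2, 3, 4} : Finset (Fin 7)), f j =
      f 0 + f 2 + f 3 + f 4 := fun f => by simp [add_assoc]
  have I5' : ∀ f : Fin 7 → ℝ, ∑ j ∈ ({0, 1, 3, 5} : Finset (Fin 7)), f j =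
      f 0 + f 1 + f 3 + f 5 := fun f => by simp [add_assoc]
  simp (disch := decide) only [Fin.sum_univ_seven, hz, I5, I5', Finset.sum_singleton, D0, D1, D2,
    D3, D5, D5', zero_add, add_zero] at K0 K1 K2 K3 K4 K6 Q1 Q2 Q3 P0 P2 P3 P4 P0' P1' P3' P5'
  rw [hA 0, hA 1, hA 2, hA 3, hB 0, hB 1, hB 2, hB 3, h23 4 6 5] at K4
  rw [hA 0, hA 1, hA 2, hA 3, hB 0, hB 1, hB 2, hB 3, h12 6 4 5, h23 4 6 5, h12 6 5 4, h23 5 6 4,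
    h12 5 4 6] at K6
  rw [hA 0, hA 2, hA 3, hB 0, hB 2, hB 3] at P4
  rw [hA 0, hA 1, hA 3, hB 0, hB 1, hB 3] at P5'
  push_cast at *
  -- `P0`, `P2`, `P3`, `P4` combine to `3r₂ + 15r₃ = 11γ`, so the bounds `3r₂ ≤ γ` and `3r₃ ≤ 2γ`
  -- are attained.
  have hγ : 3 * r₂ = γ := by linarith
  have hγ' : 3 * r₁ = γ' := by linarith
  -- Both equal `3r₃/2`, by way of the common `A₃`.
  have hγγ : γ = γ' := by linarith
  have hdim : (Module.finrank ℝ (V 6) : ℝ) = 60 - 72 * γ := by linarith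
  have h456 : structureCoeff e 4 5 6 = 8 - 8 * γ := by linarith
  have h066 : structureCoeff e 0 6 6 = 0 := by
    -- Here `(044) = (055) = γ`. Nonnegativity of `(066) = 1 - 2γ` gives `γ ≤ 1/2`, so `(456) = 8 -
    -- 8γ` is nonzero.
    rcases hV.structureCoeff_zero_six_six he (by linarith) D5 D5' (by linarith) with h | h
    · exact h
    · exfalso
      apply int_quadratic_ne_zero (60 - Module.finrank ℝ (V 6))
      have : ((60 : ℝ) - Module.finrank ℝ (V 6)) ^ 2 - 68 * (60 - Module.finrank ℝ (V 6)) + 288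
          = 0 := by
        rw [hdim] at h ⊢
        have e1 : structureCoeff e 0 4 4 = γ := by linarith
        have e2 : structureCoeff e 0 6 6 = 1 - 2 * γ := by linarith
        rw [e1, e2] at h
        linarith
      exact_mod_cast this
  -- Now `1 - 2γ = 0`, and each remaining value is an affine function of `γ` at `1/2`.
  refine ⟨⟨?_, ?_, h066, ?_⟩, ⟨?_, h144, ?_, ?_⟩, ⟨?_, ?_, h255, ?_⟩, ⟨?_, ?_, ?_, ?_⟩,
    fun i j k h => hV.structureCoeff_eq_zero_of_notMem e (by simpa [e6IITriples] using h)⟩ <;>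
    linarith
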